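/- Let $p$ be an odd prime and let $G$ be a quasi-powerful $p$-group, that is, a finite $p$-group such that $\bar G = G/Z(G)$ is powerful, i.e. $[\bar G,\bar G]\le \bar G^{p}$. For a non-negative integer $i$ let $G^{p^i}=\langle g^{p^i} : g\in G\rangle$ and $\Omega_i(G)=\langle g\in G : g^{p^i}=1\rangle$, and write $o(g)$ for the order of $g$. Then for every integer $i\ge 0$: (i) if $a,b\in G$ both have order at most $p^i$, then $ab$ has order at most $p^i$; equivalently, $\exp\Omega_i(G)\le p^i$; (ii) $G^{p^i}=\{g^{p^i} : g\in G\}$; (iii) $|G:G^{p^i}|=|\Omega_i(G)|$. In particular, $G$ has a regular power structure, which means that for all integers $i\ge 1$ one has $G^{p^i}=\{g^{p^i} : g\in G\}$, $\Omega_i(G)=\{g\in G : o(g)\le p^i\}$ and $|G:G^{p^i}|=|\Omega_i(G)|$. -/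

import Mathlib

/-- The subgroup `G^n` of `G` generated by all `n`-th powers of elements of `G`.
For `n = p ^ i` this is the `i`-th agemo subgroup of a `p`-group. -/
def powerSubgroup (G : Type*) [Group G] (n : ℕ) : Subgroup G :=
  Subgroup.closure {x : G | ∃ g : G, g ^ n = x}

/-- The `i`-th omega subgroup of `G` (with respect to `p`): the subgroup generated by all
elements `g` with `g ^ (p ^ i) = 1`. -/
def omegaSubgroup (G : Type*) [Group G] (p i : ℕ) : Subgroup G :=
  Subgroup.closure {g : G | g ^ (p ^ i) = 1}

/-- A powerful `p`-group: a finite `p`-group with `[G, G] ≤ G ^ p` for `p` odd and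
`[G, G] ≤ G ^ 4` for `p = 2`. -/
structure IsPowerfulPGroup (p : ℕ) (G : Type*) [Group G] : Prop where
  finite : Finite G
  isPGroup : IsPGroup p G
  commutator_le : commutator G ≤ powerSubgroup G (if p = 2 then 4 else p)

/-- A quasi-powerful `p`-group (for an odd prime `p`): a finite `p`-group `G` such that
`G / Z(G)` is powerful. -/
structure IsQuasiPowerfulPGroup (p : ℕ) (G : Type*) [Group G] : Prop where
  finite : Finite G
  isPGroup : IsPGroup p G
  powerful_quotient : IsPowerfulPGroup p (G ⧸ Subgroup.center G)

/-- A finite `p`-group with a regular power structure. -/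
structure HasRegularPowerStructure (p : ℕ) (G : Type*) [Group G] : Prop where
  finite : Finite G
  isPGroup : IsPGroup p G
  power_eq : ∀ i : ℕ, 0 < i →
    (powerSubgroup G (p ^ i) : Set G) = {x : G | ∃ g : G, g ^ (p ^ i) = x}
  omega_eq : ∀ i : ℕ, 0 < i →
    (omegaSubgroup G p i : Set G) = {g : G | orderOf g ≤ p ^ i}
  index_eq : ∀ i : ℕ, 0 < i →
    (powerSubgroup G (p ^ i)).index = Nat.card (omegaSubgroup G p i)

open scoped commutatorElement

/-!
Let `p` be an odd prime and `G` a finite `p`-group with `[G, G] ≤ G ^ p Z(G)`; this condition passes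
to quotients and to the subgroups used below. Only commutator collection in class two is needed.

*Powers.* The subgroup `L = G ^ p Z(G)` satisfies `[L, G] ≤ L ^ p` (`commutator_powersOf_le`), so
every subgroup `⟨x⟩ L` is powerful, and it is proper unless `G` is abelian. Modulo `L ^ p` the
`p`-th power map is a homomorphism, so an element of `G ^ p` has the form `x ^ p * v` with
`v ∈ L ^ p`; it lies in `(⟨x⟩ L) ^ p`, and induction on the order shows that it is a `p`-th power
(`IsQuasiPowerful.exists_pow_prime_eq`). Since `G ^ (p ^ i)` is again quasi-powerful, this iterates
to all `i`.

*Orders.* The central statement (`IsQuasiPowerful.isPowHomModCenter_and_powCommuteModCenter`) is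
that `(x * y) ^ p = x ^ p * y ^ p` whenever `x ^ p` and `y ^ p` are central. The commutator `d` of
`x` and `y` has order dividing `p` by induction applied to `⟨y⟩ L`, and it lies in `L`; what is
needed is that `d` commutes with `x` and `y`. This is the case `r = 1` of the statement that
`k ^ (p ^ r)` and `h` commute if `h ^ (p ^ r)` and `k ^ (p ^ (r + 1))` are central, which is trivial
for large `r` and proved by downward induction on `r` (`PowCommuteModCenter.of_succ`). So the
elements of order at most `p` form a subgroup `Ω₁(G)`, and the quotient by it gives the same
for `p ^ i`.

*Index.* The `p`-th power map is thus a homomorphism from `{x | x ^ p ∈ Z(G)}` to `Z(G)`, with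
kernel `Ω₁(G)` and range `Z(G) ∩ G ^ p`. Counting with it and induction through `G ⧸ Z(G)` give
`|G ^ p| |Ω₁(G)| = |G|`, and induction through `G ⧸ Ω₁(G)` gives the same for `p ^ i`.
-/

universe u

/-! ### Collecting powers in class two -/

/-- If `d` is the commutator of `c` and `x` and commutes with both, then `⟨x, c⟩` has class at most
two and the `n`-th power of `x * c` is given by the collection formula. -/
theorem mul_pow_of_commutator_commute {G : Type*} [Group G] {x c d : G} (h : c * x = x * c * d)
    (hx : Commute d x) (hc : Commute d c) (n : ℕ) :
    (x * c) ^ n = x ^ n * c ^ n * d ^ n.choose 2 := by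
  have h2 : ∀ n : ℕ, c ^ n * x = x * c ^ n * d ^ n := by
    intro n
    induction n with
    | zero => simp
    | succ n ih =>
      calc c ^ (n + 1) * x = c ^ n * (c * x) := by rw [pow_succ, mul_assoc]
        _ = (c ^ n * x) * c * d := by rw [h]; group
        _ = x * c ^ n * (d ^ n * c) * d := by rw [ih]; group
        _ = x * c ^ n * (c * d ^ n) * d := by rw [(hc.pow_left n).eq]
        _ = x * c ^ (n + 1) * d ^ (n + 1) := by rw [pow_succ c, pow_succ d]; group
  induction n with
  | zero => simp
  | succ n ih =>
    have hd : Commute (d ^ n.choose 2) (x * c) := ((hx.mul_right hc).pow_left _)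
    calc (x * c) ^ (n + 1) = x ^ n * c ^ n * (d ^ n.choose 2 * (x * c)) := by
          rw [pow_succ, ih]; group
      _ = x ^ n * (c ^ n * x) * c * d ^ n.choose 2 := by rw [hd.eq]; group
      _ = x ^ n * x * c ^ n * (d ^ n * c) * d ^ n.choose 2 := by rw [h2 n]; group
      _ = x ^ n * x * c ^ n * (c * d ^ n) * d ^ n.choose 2 := by rw [(hc.pow_left n).eq]
      _ = x ^ (n + 1) * c ^ (n + 1) * d ^ (n + 1).choose 2 := by
          rw [Nat.choose_succ_succ' n 1, Nat.choose_one_right, pow_add d, pow_succ x, pow_succ c]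
          group

theorem mul_pow_prime_of_commutator_commute {G : Type*} [Group G] {p : ℕ} (hp : p.Prime)
    (hodd : Odd p) {x c d : G} (h : c * x = x * c * d)
    (hx : Commute d x) (hc : Commute d c) (hd : d ^ p = 1) :
    (x * c) ^ p = x ^ p * c ^ p := by
  have h2 : 2 < p := by
    have := hp.two_le
    rcases hodd with ⟨k, hk⟩
    omega
  obtain ⟨m, hm⟩ := hp.dvd_choose_self two_ne_zero h2
  rw [mul_pow_of_commutator_commute h hx hc, hm, pow_mul, hd, one_pow, mul_one]

/-- If `c ^ p` is trivial then so is the `p`-th power of the commutator of `c` and `x`, so that the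
collection formula for an odd prime leaves only `x ^ p`. -/
theorem mul_pow_prime_of_pow_eq_one {G : Type*} [Group G] {p : ℕ} (hp : p.Prime)
    (hodd : Odd p) {x c d : G} (h : c * x = x * c * d)
    (hx : Commute d x) (hc : Commute d c) (hcp : c ^ p = 1) :
    (x * c) ^ p = x ^ p := by
  have hd : d ^ p = 1 := by
    have hdc : x⁻¹ * c * x = c * d := by rw [mul_assoc, h]; group
    have := congrArg (· ^ p) hdc
    have hconj : (x⁻¹ * c * x) ^ p = x⁻¹ * c ^ p * x := by
      simpa using conj_pow (a := x⁻¹) (b := c) (i := p)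
    simpa [hc.symm.mul_pow, hcp, hconj] using this.symm
  rw [mul_pow_prime_of_commutator_commute hp hodd h hx hc hd, hcp, mul_one]

/-! ### Power subgroups and commutators -/

/-- The subgroup of `G` generated by the `n`-th powers of the elements of a subgroup `H`; it is the
image in `G` of `powerSubgroup H n`. -/
def Subgroup.powersOf {G : Type*} [Group G] (H : Subgroup G) (n : ℕ) : Subgroup G :=
  Subgroup.closure {x : G | ∃ h ∈ H, h ^ n = x}

section Powers

variable {G : Type*} [Group G]

theorem pow_mem_powerSubgroup (g : G) (n : ℕ) : g ^ n ∈ powerSubgroup G n :=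
  Subgroup.subset_closure ⟨g, rfl⟩

theorem Subgroup.pow_mem_powersOf {H : Subgroup G} {g : G} (hg : g ∈ H) (n : ℕ) :
    g ^ n ∈ H.powersOf n :=
  Subgroup.subset_closure ⟨g, hg, rfl⟩

theorem Subgroup.powersOf_le_iff {H K : Subgroup G} {n : ℕ} :
    H.powersOf n ≤ K ↔ ∀ h ∈ H, h ^ n ∈ K := by
  constructor
  · exact fun h x hx => h (pow_mem_powersOf hx n)
  · rintro h
    refine (Subgroup.closure_le K).2 ?_
    rintro _ ⟨x, hx, rfl⟩
    exact h x hx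

theorem powerSubgroup_le_iff {K : Subgroup G} {n : ℕ} :
    powerSubgroup G n ≤ K ↔ ∀ g : G, g ^ n ∈ K := by
  constructor
  · exact fun h x => h (pow_mem_powerSubgroup x n)
  · rintro h
    refine (Subgroup.closure_le K).2 ?_
    rintro _ ⟨x, rfl⟩
    exact h x

theorem powersOf_top (n : ℕ) : (⊤ : Subgroup G).powersOf n = powerSubgroup G n := by
  simp [Subgroup.powersOf, powerSubgroup]

theorem Subgroup.powersOf_mono {H K : Subgroup G} (h : H ≤ K) (n : ℕ) :
    H.powersOf n ≤ K.powersOf n :=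
  powersOf_le_iff.2 fun _ hx => pow_mem_powersOf (h hx) n

theorem map_powerSubgroup {G' : Type*} [Group G'] (f : G →* G') (n : ℕ) :
    (powerSubgroup G n).map f = f.range.powersOf n := by
  rw [powerSubgroup, MonoidHom.map_closure, Subgroup.powersOf]
  congr 1
  ext x
  simp

theorem map_powerSubgroup_of_surjective {G' : Type*} [Group G'] {f : G →* G'}
    (hf : Function.Surjective f) (n : ℕ) :
    (powerSubgroup G n).map f = powerSubgroup G' n := by
  rw [map_powerSubgroup, MonoidHom.range_eq_top.2 hf, powersOf_top]

theorem map_subtype_powerSubgroup (H : Subgroup G) (n : ℕ) :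
    (powerSubgroup H n).map H.subtype = H.powersOf n := by
  rw [map_powerSubgroup, Subgroup.range_subtype]

instance Subgroup.powersOf_normal (H : Subgroup G) [H.Normal] (n : ℕ) : (H.powersOf n).Normal := by
  refine ⟨fun y hy g => ?_⟩
  have : H.powersOf n ≤ (H.powersOf n).comap (MulAut.conj g).toMonoidHom :=
    powersOf_le_iff.2 fun x hx => by
      simpa [Subgroup.mem_comap, conj_pow] using
        pow_mem_powersOf (Subgroup.Normal.conj_mem inferInstance x hx g) n
  simpa using this hy

instance powerSubgroup_normal (n : ℕ) : (powerSubgroup G n).Normal := by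
  rw [← powersOf_top]; infer_instance

/-- Nakayama's lemma for nilpotent groups. -/
theorem le_of_le_sup_commutator [Group.IsNilpotent G] {M K : Subgroup G} [K.Normal]
    (h : M ≤ K ⊔ ⁅M, (⊤ : Subgroup G)⁆) : M ≤ K := by
  have key : ∀ n, M ≤ K ⊔ (⊤ : Subgroup G).lowerCentralSeries n := by
    intro n
    induction n with
    | zero => simp
    | succ n ih =>
      refine h.trans (sup_le le_sup_left (Subgroup.commutator_le.2 fun m hm g _ => ?_))
      obtain ⟨k, hk, l, hl, rfl⟩ := Subgroup.mem_sup_of_normal_left.1 (ih hm)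
      have e : ⁅k * l, g⁆ = (k * ⁅l, g⁆ * k⁻¹) * ⁅k, g⁆ := by
        simp only [commutatorElement_def]; group
      rw [e]
      refine mul_mem (Subgroup.Normal.conj_mem inferInstance _ (Subgroup.mem_sup_right ?_) _)
        (Subgroup.mem_sup_left ?_)
      · exact Subgroup.commutator_mem_commutator hl (Subgroup.mem_top g)
      · exact Subgroup.commutator_le_left K ⊤
          (Subgroup.commutator_mem_commutator hk (Subgroup.mem_top g))
  obtain ⟨n, hn⟩ := Subgroup.nilpotent_iff_lowerCentralSeries.1 ‹Group.IsNilpotent G›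
  simpa [hn] using key n

theorem mk_commute_of_commutator_le {M J : Subgroup G} [J.Normal]
    (h : ⁅M, (⊤ : Subgroup G)⁆ ≤ J) {m : G} (hm : m ∈ M) (g : G) :
    Commute (m : G ⧸ J) (g : G ⧸ J) := by
  have := (QuotientGroup.eq_one_iff (N := J) _).2
    (h (Subgroup.commutator_mem_commutator hm (Subgroup.mem_top g)))
  rw [← commutatorElement_eq_one_iff_commute]
  exact this

/-- The commutator calculus behind powerful `p`-groups. Modulo `L ^ p` and `[N ^ p, G, G]`, the
commutator `c` of `x ∈ N` with any element has trivial `p`-th power and `[c, x]` is central, so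
`x ^ p` is central; the second of these two subgroups is dropped by nilpotency. -/
theorem commutator_powersOf_le [Group.IsNilpotent G] {p : ℕ} (hp : p.Prime) (hodd : Odd p)
    {N L : Subgroup G} [N.Normal] [L.Normal] (h1 : ⁅N, (⊤ : Subgroup G)⁆ ≤ L)
    (h2 : ⁅L, (⊤ : Subgroup G)⁆ ≤ ⁅N.powersOf p, (⊤ : Subgroup G)⁆) :
    ⁅N.powersOf p, (⊤ : Subgroup G)⁆ ≤ L.powersOf p := by
  apply le_of_le_sup_commutator
  set M := ⁅N.powersOf p, (⊤ : Subgroup G)⁆ with hM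
  set J := L.powersOf p ⊔ ⁅M, (⊤ : Subgroup G)⁆ with hJ
  have hcen : N.powersOf p ≤ (Subgroup.center (G ⧸ J)).comap (QuotientGroup.mk' J) := by
    refine Subgroup.powersOf_le_iff.2 fun x hx => Subgroup.mem_center_iff.2 fun q => ?_
    obtain ⟨g, rfl⟩ := QuotientGroup.mk_surjective q
    set c := x⁻¹ * (g * x * g⁻¹) with hc
    set d := c⁻¹ * x⁻¹ * c * x with hd
    have hcL : c ∈ L := by
      have := h1 (Subgroup.commutator_mem_commutator (inv_mem hx) (Subgroup.mem_top g))
      simpa [commutatorElement_def, hc, mul_assoc] using this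
    have hdM : d ∈ M := by
      have := h2 (Subgroup.commutator_mem_commutator (inv_mem hcL) (Subgroup.mem_top x⁻¹))
      simpa [commutatorElement_def, hd, mul_assoc] using this
    have hdq : ∀ g : G, Commute (d : G ⧸ J) (g : G ⧸ J) :=
      mk_commute_of_commutator_le le_sup_right hdM
    have hcp : (c : G ⧸ J) ^ p = 1 :=
      (QuotientGroup.eq_one_iff (N := J) _).2
        (Subgroup.mem_sup_left (Subgroup.pow_mem_powersOf hcL p))
    have hcx : (c : G ⧸ J) * (x : G ⧸ J) = x * c * d := by
      simp only [hd, QuotientGroup.mk_mul, QuotientGroup.mk_inv]; group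
    have := mul_pow_prime_of_pow_eq_one hp hodd hcx (hdq x) (hdq c) hcp
    have e : (x : G ⧸ J) * c = g * x * (g : G ⧸ J)⁻¹ := by
      simp only [hc, QuotientGroup.mk_mul, QuotientGroup.mk_inv]; group
    rw [e, conj_pow, mul_inv_eq_iff_eq_mul] at this
    simpa using this
  refine Subgroup.commutator_le.2 fun a ha g _ => ?_
  rw [← QuotientGroup.eq_one_iff (N := J)]
  have := (Subgroup.mem_center_iff.1 (hcen ha) (g : G ⧸ J))
  exact commutatorElement_eq_one_iff_commute.2 (show Commute (a : G ⧸ J) (g : G ⧸ J) from this.symm)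

end Powers

/-! ### Quasi-powerful groups -/

/-- The commutator condition on a quasi-powerful `p`-group for odd `p`, with the quotient by the
centre unfolded: `[G, G] ≤ G ^ p Z(G)`. -/
def IsQuasiPowerful (p : ℕ) (G : Type*) [Group G] : Prop :=
  commutator G ≤ powerSubgroup G p ⊔ Subgroup.center G

/-- The subgroup `G ^ n Z(G)`. -/
def powerCenter (G : Type*) [Group G] (n : ℕ) : Subgroup G :=
  powerSubgroup G n ⊔ Subgroup.center G

section QuasiPowerful

variable {G : Type*} [Group G] {p : ℕ}

instance powerCenter_normal (n : ℕ) : (powerCenter G n).Normal := by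
  unfold powerCenter; infer_instance

theorem mem_powerCenter_iff {n : ℕ} {x : G} :
    x ∈ powerCenter G n ↔ ∃ a ∈ powerSubgroup G n, ∃ z ∈ Subgroup.center G, a * z = x :=
  Subgroup.mem_sup_of_normal_right

theorem IsQuasiPowerfulPGroup.isQuasiPowerful (h : IsQuasiPowerfulPGroup p G) (h2 : p ≠ 2) :
    IsQuasiPowerful p G := by
  have h1 := h.powerful_quotient.commutator_le
  rw [if_neg h2] at h1
  have hs := QuotientGroup.mk'_surjective (Subgroup.center G)
  rw [← map_powerSubgroup_of_surjective hs] at h1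
  intro x hx
  have hx' : (x : G ⧸ Subgroup.center G) ∈ commutator (G ⧸ Subgroup.center G) := by
    have := Subgroup.mem_map_of_mem (QuotientGroup.mk' (Subgroup.center G)) hx
    rw [commutator_def, Subgroup.map_commutator] at this
    exact Subgroup.commutator_mono le_top le_top this
  obtain ⟨a, ha, hax⟩ := h1 hx'
  exact mem_powerCenter_iff.2 ⟨a, ha, a⁻¹ * x, QuotientGroup.eq.1 hax, by group⟩

theorem IsQuasiPowerful.quotient (h : IsQuasiPowerful p G) (N : Subgroup G) [N.Normal] :
    IsQuasiPowerful p (G ⧸ N) := by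
  have hs := QuotientGroup.mk'_surjective N
  have h1 := Subgroup.map_mono (f := QuotientGroup.mk' N) h
  rw [Subgroup.map_sup, map_powerSubgroup_of_surjective hs, commutator_def,
    Subgroup.map_commutator, Subgroup.map_top_of_surjective _ hs, ← commutator_def] at h1
  refine h1.trans (sup_le_sup_left ?_ _)
  rintro _ ⟨z, hz, rfl⟩
  refine Subgroup.mem_center_iff.2 fun q => ?_
  obtain ⟨g, rfl⟩ := hs q
  rw [← map_mul, ← map_mul, Subgroup.mem_center_iff.1 hz g]

theorem isQuasiPowerful_coe {H : Subgroup G}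
    (h : ⁅H, H⁆ ≤ H.powersOf p ⊔ Subgroup.center G) : IsQuasiPowerful p H := by
  intro x hx
  have hx' : (x : G) ∈ ⁅H, H⁆ := by
    have := Subgroup.mem_map_of_mem H.subtype hx
    rwa [commutator_def, Subgroup.map_commutator, ← MonoidHom.range_eq_map,
      Subgroup.range_subtype] at this
  obtain ⟨a, ha, z, hz, haz⟩ := Subgroup.mem_sup_of_normal_right.1 (h hx')
  rw [← map_subtype_powerSubgroup] at ha
  obtain ⟨b, hb, rfl⟩ := ha
  refine mem_powerCenter_iff.2 ⟨b, hb, b⁻¹ * x, ?_, by group⟩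
  have hz' : ((b⁻¹ * x : H) : G) = z := by simp [← haz]
  refine Subgroup.mem_center_iff.2 fun y => Subtype.ext ?_
  simpa only [Subgroup.coe_mul, hz'] using Subgroup.mem_center_iff.1 hz y

theorem commutator_powerCenter_le (n : ℕ) :
    ⁅powerCenter G n, (⊤ : Subgroup G)⁆ ≤ ⁅powerSubgroup G n, (⊤ : Subgroup G)⁆ := by
  refine Subgroup.commutator_le.2 fun x hx g _ => ?_
  obtain ⟨a, ha, z, hz, rfl⟩ := mem_powerCenter_iff.1 hx
  have e : ⁅a * z, g⁆ = ⁅a, g⁆ := by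
    have h1 : z * g = g * z := (Subgroup.mem_center_iff.1 hz g).symm
    calc a * z * g * (a * z)⁻¹ * g⁻¹ = a * (z * g) * (a * z)⁻¹ * g⁻¹ := by group
      _ = a * g * a⁻¹ * g⁻¹ := by rw [h1]; group
  rw [e]
  exact Subgroup.commutator_mem_commutator ha (Subgroup.mem_top g)

theorem IsQuasiPowerful.commutator_le (h : IsQuasiPowerful p G) :
    ⁅(⊤ : Subgroup G), (⊤ : Subgroup G)⁆ ≤ powerCenter G p := h

/-- `G ^ p Z(G)` is powerfully embedded in a quasi-powerful group `G`. -/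
theorem IsQuasiPowerful.commutator_powerCenter_le [Group.IsNilpotent G] (hp : p.Prime)
    (hodd : Odd p) (h : IsQuasiPowerful p G) :
    ⁅powerCenter G p, (⊤ : Subgroup G)⁆ ≤ (powerCenter G p).powersOf p := by
  refine (_root_.commutator_powerCenter_le p).trans ?_
  rw [← powersOf_top]
  refine commutator_powersOf_le hp hodd h.commutator_le ?_
  rw [powersOf_top]
  exact _root_.commutator_powerCenter_le p

/-- In a finite `p`-group the subgroup `G ^ p` consists of non-generators. -/
theorem IsPGroup.sup_powerSubgroup_ne_top [Finite G] (hp : p.Prime) (hG : IsPGroup p G)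
    {B : Subgroup G} (hB : B ≠ ⊤) : B ⊔ powerSubgroup G p ≠ ⊤ := by
  have : Fact p.Prime := ⟨hp⟩
  obtain ⟨n, hn⟩ := IsPGroup.iff_card.1 hG
  obtain ⟨m, hm⟩ := IsPGroup.iff_card.1 (hG.to_subgroup B)
  have hlt : p ^ m < p ^ n := by
    rw [← hn, ← hm]
    exact lt_of_le_of_ne (Subgroup.card_le_card_group B) fun e => hB (Subgroup.eq_top_of_card_eq B e)
  have hmn : m < n := (Nat.pow_lt_pow_iff_right hp.one_lt).1 hlt
  obtain ⟨k, rfl⟩ : ∃ k, n = k + 1 := ⟨n - 1, by omega⟩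
  obtain ⟨K, hK, hBK⟩ := Sylow.exists_subgroup_card_pow_prime_le p
    (show p ^ k ∣ Nat.card G by rw [hn]; exact pow_dvd_pow _ (by omega)) B hm (by omega)
  have hidx : K.index = p := by
    have := K.card_mul_index
    rw [hK, hn, pow_succ] at this
    exact Nat.eq_of_mul_eq_mul_left (pow_pos hp.pos k) this
  have : K.Normal := Subgroup.normal_of_index_eq_minFac_card
    (by rw [hidx, hn, hp.pow_minFac (by omega)])
  have hle : B ⊔ powerSubgroup G p ≤ K :=
    sup_le hBK (powerSubgroup_le_iff.2 fun g => hidx ▸ K.pow_index_mem g)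
  intro e
  rw [e, top_le_iff] at hle
  rw [hle, Subgroup.index_top] at hidx
  exact hp.one_lt.ne hidx

/-- The subgroup `⟨x⟩ G ^ p Z(G)`, to which induction on the group order is applied. -/
def zpowersPowerCenter (p : ℕ) (x : G) : Subgroup G :=
  Subgroup.zpowers x ⊔ powerCenter G p

theorem self_mem_zpowersPowerCenter (x : G) : x ∈ zpowersPowerCenter p x :=
  Subgroup.mem_sup_left (Subgroup.mem_zpowers x)

theorem powerCenter_le_zpowersPowerCenter (x : G) : powerCenter G p ≤ zpowersPowerCenter p x :=
  le_sup_right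

theorem zpowersPowerCenter_one : zpowersPowerCenter p (1 : G) = powerCenter G p := by
  simp [zpowersPowerCenter]

theorem IsQuasiPowerful.zpowersPowerCenter_normal (h : IsQuasiPowerful p G) (x : G) :
    (zpowersPowerCenter p x).Normal := by
  refine ⟨fun t ht g => ?_⟩
  have : g * t * g⁻¹ = ⁅g, t⁆ * t := by rw [commutatorElement_def]; group
  rw [this]
  exact mul_mem (powerCenter_le_zpowersPowerCenter x (h.commutator_le
    (Subgroup.commutator_mem_commutator (Subgroup.mem_top g) (Subgroup.mem_top t)))) ht

/-- The commutator subgroup of `⟨x⟩ G ^ p Z(G)` lies in `[G ^ p Z(G), G] ≤ (G ^ p Z(G)) ^ p`, so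
this subgroup is even powerful. -/
theorem IsQuasiPowerful.zpowersPowerCenter [Group.IsNilpotent G] (hp : p.Prime) (hodd : Odd p)
    (h : IsQuasiPowerful p G) (x : G) : IsQuasiPowerful p (zpowersPowerCenter p x) := by
  refine isQuasiPowerful_coe (le_sup_of_le_left ?_)
  refine le_trans ?_ ((h.commutator_powerCenter_le hp hodd).trans
    (Subgroup.powersOf_mono (powerCenter_le_zpowersPowerCenter x) p))
  -- modulo `[G ^ p Z(G), G]` the group `⟨x⟩ G ^ p Z(G)` is a cyclic group times a central one
  refine Subgroup.commutator_le.2 fun a ha b hb => ?_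
  obtain ⟨u, hu, l, hl, rfl⟩ := Subgroup.mem_sup_of_normal_right.1 ha
  obtain ⟨v, hv, m, hm, rfl⟩ := Subgroup.mem_sup_of_normal_right.1 hb
  obtain ⟨i, rfl⟩ := Subgroup.mem_zpowers_iff.1 hu
  obtain ⟨j, rfl⟩ := Subgroup.mem_zpowers_iff.1 hv
  set J := ⁅powerCenter G p, (⊤ : Subgroup G)⁆
  have hc : ∀ y ∈ powerCenter G p, ∀ g : G, Commute (y : G ⧸ J) (g : G ⧸ J) :=
    fun y hy g => mk_commute_of_commutator_le le_rfl hy g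
  rw [← QuotientGroup.eq_one_iff (N := J)]
  refine commutatorElement_eq_one_iff_commute.2 (?_ :
    Commute ((x ^ i * l : G) : G ⧸ J) ((x ^ j * m : G) : G ⧸ J))
  rw [QuotientGroup.mk_mul, QuotientGroup.mk_mul]
  refine Commute.mul_left ?_ (hc l hl _)
  refine Commute.mul_right ?_ (hc m hm _).symm
  exact (((Commute.refl x).zpow_left i).zpow_right j).map (QuotientGroup.mk' J)

theorem IsPGroup.zpowersPowerCenter_ne_top [Finite G] (hp : p.Prime) (hG : IsPGroup p G)
    (hcomm : ¬ ∀ a b : G, a * b = b * a) (x : G) : zpowersPowerCenter p x ≠ ⊤ := by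
  have hB : Subgroup.zpowers x ⊔ Subgroup.center G ≠ ⊤ := by
    intro e
    refine hcomm fun a b => ?_
    have ha : a ∈ Subgroup.zpowers x ⊔ Subgroup.center G := e ▸ Subgroup.mem_top a
    have hb : b ∈ Subgroup.zpowers x ⊔ Subgroup.center G := e ▸ Subgroup.mem_top b
    obtain ⟨u, hu, l, hl, rfl⟩ := Subgroup.mem_sup_of_normal_right.1 ha
    obtain ⟨v, hv, m, hm, rfl⟩ := Subgroup.mem_sup_of_normal_right.1 hb
    obtain ⟨i, rfl⟩ := Subgroup.mem_zpowers_iff.1 hu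
    obtain ⟨j, rfl⟩ := Subgroup.mem_zpowers_iff.1 hv
    have hl' : ∀ g, Commute l g := fun g => (Subgroup.mem_center_iff.1 hl g).symm
    have hm' : ∀ g, Commute g m := fun g => Subgroup.mem_center_iff.1 hm g
    exact Commute.mul_left ((((Commute.refl x).zpow_left i).zpow_right j).mul_right (hm' _)) (hl' _)
  have := hG.sup_powerSubgroup_ne_top hp hB
  rwa [zpowersPowerCenter, powerCenter, sup_comm (powerSubgroup G p), ← sup_assoc]

theorem card_lt_of_ne_top [Finite G] {H : Subgroup G} (h : H ≠ ⊤) : Nat.card H < Nat.card G :=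
  lt_of_le_of_ne (Subgroup.card_le_card_group H) fun e => h (Subgroup.eq_top_of_card_eq H e)

/-! ### Elements of power subgroups are powers -/

/-- In a quasi-powerful group the `p`-th power map is a homomorphism modulo `(G ^ p Z(G)) ^ p`. -/
theorem IsQuasiPowerful.exists_pow_mul [Group.IsNilpotent G] (hp : p.Prime)
    (hodd : Odd p) (h : IsQuasiPowerful p G) {w : G} (hw : w ∈ powerSubgroup G p) :
    ∃ x : G, ∃ v ∈ (powerCenter G p).powersOf p, w = x ^ p * v := by
  set J := (powerCenter G p).powersOf p with hJ
  suffices hs : ∃ x : G, (w : G ⧸ J) = (x : G ⧸ J) ^ p by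
    obtain ⟨x, hx⟩ := hs
    exact ⟨x, (x ^ p)⁻¹ * w, QuotientGroup.eq.1 (by simpa using hx.symm), by group⟩
  have hmul : ∀ x y : G, ((x : G ⧸ J) * y) ^ p = (x : G ⧸ J) ^ p * (y : G ⧸ J) ^ p := by
    intro x y
    set d := y⁻¹ * x⁻¹ * y * x with hd
    have hdL : d ∈ powerCenter G p := by
      have := h.commutator_le
        (Subgroup.commutator_mem_commutator (Subgroup.mem_top y⁻¹) (Subgroup.mem_top x⁻¹))
      simpa [commutatorElement_def, hd, mul_assoc] using this
    have hdc : ∀ g : G, Commute (d : G ⧸ J) (g : G ⧸ J) :=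
      mk_commute_of_commutator_le (h.commutator_powerCenter_le hp hodd) hdL
    refine mul_pow_prime_of_commutator_commute hp hodd ?_ (hdc x) (hdc y)
      ((QuotientGroup.eq_one_iff (N := J) _).2 (Subgroup.pow_mem_powersOf hdL p))
    simp only [hd, QuotientGroup.mk_mul, QuotientGroup.mk_inv]; group
  induction hw using Subgroup.closure_induction with
  | mem w hw =>
    obtain ⟨x, rfl⟩ := hw
    exact ⟨x, rfl⟩
  | one => exact ⟨1, by simp⟩
  | mul a b _ _ ha hb =>
    obtain ⟨x, hx⟩ := ha
    obtain ⟨y, hy⟩ := hb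
    exact ⟨x * y, by rw [QuotientGroup.mk_mul, QuotientGroup.mk_mul, hx, hy, hmul]⟩
  | inv a _ ha =>
    obtain ⟨x, hx⟩ := ha
    exact ⟨x⁻¹, by rw [QuotientGroup.mk_inv, QuotientGroup.mk_inv, hx, inv_pow]⟩

end QuasiPowerful

theorem IsPGroup.group_isNilpotent {G : Type*} [Group G] [Finite G] {p : ℕ} (hp : p.Prime)
    (hG : IsPGroup p G) : Group.IsNilpotent G :=
  have : Fact p.Prime := ⟨hp⟩
  hG.isNilpotent

/-- Every element of `G ^ p` is a `p`-th power. If `w = x ^ p * v` as in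
`IsQuasiPowerful.exists_pow_mul`, then `w` already lies in the `p`-th power subgroup of the smaller
group `⟨x⟩ G ^ p Z(G)`. -/
theorem IsQuasiPowerful.exists_pow_prime_eq {p : ℕ} (hp : p.Prime) (hodd : Odd p)
    {G : Type u} [Group G] [Finite G] (hG : IsPGroup p G) (h : IsQuasiPowerful p G)
    {w : G} (hw : w ∈ powerSubgroup G p) : ∃ g : G, g ^ p = w := by
  induction hn : Nat.card G using Nat.strong_induction_on generalizing G with
  | _ n ih =>
    subst hn
    have := hG.group_isNilpotent hp
    by_cases hcomm : ∀ a b : G, a * b = b * a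
    · induction hw using Subgroup.closure_induction with
      | mem w hw => exact hw
      | one => exact ⟨1, one_pow p⟩
      | mul a b _ _ ha hb =>
        obtain ⟨x, rfl⟩ := ha
        obtain ⟨y, rfl⟩ := hb
        exact ⟨x * y, (show Commute x y from hcomm x y).mul_pow p⟩
      | inv a _ ha =>
        obtain ⟨x, rfl⟩ := ha
        exact ⟨x⁻¹, inv_pow x p⟩
    · obtain ⟨x, v, hv, rfl⟩ := h.exists_pow_mul hp hodd hw
      have hmem : x ^ p * v ∈ (_root_.zpowersPowerCenter p x).powersOf p :=
        mul_mem (Subgroup.pow_mem_powersOf (self_mem_zpowersPowerCenter x) p)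
          (Subgroup.powersOf_mono (powerCenter_le_zpowersPowerCenter x) p hv)
      rw [← map_subtype_powerSubgroup] at hmem
      obtain ⟨w', hw', e⟩ := hmem
      obtain ⟨g, hg⟩ := ih _ (card_lt_of_ne_top (hG.zpowersPowerCenter_ne_top hp hcomm x))
        (hG.to_subgroup _) (h.zpowersPowerCenter hp hodd x) hw' rfl
      exact ⟨g, by rw [← e, ← hg]; rfl⟩

section Chain

variable {p : ℕ} {G : Type u} [Group G]

theorem powerSubgroup_pow_succ_le (i : ℕ) :
    powerSubgroup G (p ^ (i + 1)) ≤ (powerSubgroup G (p ^ i)).powersOf p :=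
  powerSubgroup_le_iff.2 fun g => by
    rw [pow_succ, pow_mul]
    exact Subgroup.pow_mem_powersOf (pow_mem_powerSubgroup g _) p

theorem isQuasiPowerful_powerSubgroup_of_commutator_le {i : ℕ}
    (h : ⁅powerCenter G (p ^ i), (⊤ : Subgroup G)⁆ ≤ powerCenter G (p ^ (i + 1))) :
    IsQuasiPowerful p (powerSubgroup G (p ^ i)) :=
  isQuasiPowerful_coe <|
    (Subgroup.commutator_mono (le_sup_left : _ ≤ powerCenter G (p ^ i)) le_top).trans <|
      h.trans <| sup_le_sup_right (powerSubgroup_pow_succ_le i) _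

/-- The subgroups `G ^ (p ^ i) Z(G)` descend with central factors, by `commutator_powersOf_le` for
consecutive terms. So `G ^ (p ^ i)` is quasi-powerful, and
`IsQuasiPowerful.exists_pow_prime_eq` for it gives the step from `p ^ i`-th to `p ^ (i + 1)`-th
powers. The two parts are proved together, as each step of either needs the other. -/
theorem IsQuasiPowerful.exists_pow_eq_and_commutator_le [Finite G] (hp : p.Prime) (hodd : Odd p)
    (hG : IsPGroup p G) (h : IsQuasiPowerful p G) (i : ℕ) :
    (∀ w ∈ powerSubgroup G (p ^ i), ∃ g : G, g ^ p ^ i = w) ∧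
      ⁅powerCenter G (p ^ i), (⊤ : Subgroup G)⁆ ≤ powerCenter G (p ^ (i + 1)) := by
  have := hG.group_isNilpotent hp
  induction i with
  | zero =>
    refine ⟨fun w _ => ⟨w, by simp⟩, ?_⟩
    simpa using (Subgroup.commutator_mono le_top le_rfl).trans h.commutator_le
  | succ i ih =>
    have hset : ∀ w ∈ powerSubgroup G (p ^ (i + 1)), ∃ g : G, g ^ p ^ (i + 1) = w := by
      intro w hw
      have hw' := powerSubgroup_pow_succ_le i hw
      rw [← map_subtype_powerSubgroup] at hw'
      obtain ⟨v, hv, rfl⟩ := hw'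
      obtain ⟨⟨a, ha⟩, rfl⟩ := (isQuasiPowerful_powerSubgroup_of_commutator_le ih.2).exists_pow_prime_eq
        hp hodd (hG.to_subgroup _) hv
      obtain ⟨g, rfl⟩ := ih.1 a ha
      exact ⟨g, by rw [pow_succ, pow_mul]; rfl⟩
    refine ⟨hset, ?_⟩
    have h2 : ⁅powerCenter G (p ^ (i + 1)), (⊤ : Subgroup G)⁆ ≤
        ⁅(powerCenter G (p ^ i)).powersOf p, (⊤ : Subgroup G)⁆ :=
      (_root_.commutator_powerCenter_le _).trans <| Subgroup.commutator_mono
        ((powerSubgroup_pow_succ_le i).trans (Subgroup.powersOf_mono le_sup_left p)) le_rfl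
    refine (h2.trans (commutator_powersOf_le hp hodd ih.2 h2)).trans ?_
    refine Subgroup.powersOf_le_iff.2 fun x hx => ?_
    obtain ⟨a, ha, z, hz, rfl⟩ := mem_powerCenter_iff.1 hx
    obtain ⟨g, rfl⟩ := hset a ha
    have hc : Commute (g ^ p ^ (i + 1)) z := Subgroup.mem_center_iff.1 hz _
    rw [hc.mul_pow, ← pow_mul, ← pow_succ]
    exact mul_mem (Subgroup.mem_sup_left (pow_mem_powerSubgroup g _))
      (Subgroup.mem_sup_right (pow_mem hz p))

theorem IsQuasiPowerful.mem_powerSubgroup_iff [Finite G] (hp : p.Prime) (hodd : Odd p)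
    (hG : IsPGroup p G) (h : IsQuasiPowerful p G) {i : ℕ} {w : G} :
    w ∈ powerSubgroup G (p ^ i) ↔ ∃ g : G, g ^ p ^ i = w :=
  ⟨(h.exists_pow_eq_and_commutator_le hp hodd hG i).1 w,
    fun ⟨g, hg⟩ => hg ▸ pow_mem_powerSubgroup g _⟩

theorem IsQuasiPowerful.powerSubgroup [Finite G] (hp : p.Prime) (hodd : Odd p)
    (hG : IsPGroup p G) (h : IsQuasiPowerful p G) (i : ℕ) :
    IsQuasiPowerful p (powerSubgroup G (p ^ i)) :=
  isQuasiPowerful_powerSubgroup_of_commutator_le (h.exists_pow_eq_and_commutator_le hp hodd hG i).2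

end Chain

/-! ### The power map on elements of order `p` modulo the centre -/

/-- The `p`-th power map is multiplicative on the elements whose `p`-th power is central. -/
def IsPowHomModCenter (p : ℕ) (G : Type*) [Group G] : Prop :=
  ∀ x y : G, x ^ p ∈ Subgroup.center G → y ^ p ∈ Subgroup.center G → (x * y) ^ p = x ^ p * y ^ p

/-- A `p ^ r`-th power which has order at most `p` modulo the centre commutes with every element of
order at most `p ^ r` modulo the centre. -/
def PowCommuteModCenter (p : ℕ) (G : Type*) [Group G] (r : ℕ) : Prop :=
  ∀ h k : G, h ^ p ^ r ∈ Subgroup.center G → k ^ p ^ (r + 1) ∈ Subgroup.center G →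
    Commute (k ^ p ^ r) h

section

variable {p : ℕ} {G : Type u} [Group G]

/-- The hypothesis is applied to the `p`-th power map on `⟨x⟩ G ^ p Z(G)`, which contains `x` and
all its conjugates. -/
theorem pow_inv_mul_conj_eq_one (hQ : IsQuasiPowerful p G) {x : G}
    (hT : IsPowHomModCenter p (zpowersPowerCenter p x)) (hx : x ^ p ∈ Subgroup.center G) (g : G) :
    (x⁻¹ * (g * x * g⁻¹)) ^ p = 1 := by
  have hxT := self_mem_zpowersPowerCenter (p := p) x
  have hgT : g * x * g⁻¹ ∈ zpowersPowerCenter p x := (hQ.zpowersPowerCenter_normal x).conj_mem x hxT g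
  have hgx : (g * x * g⁻¹) ^ p = x ^ p := by
    rw [conj_pow, Subgroup.mem_center_iff.1 hx g]; group
  have hc : ∀ a : zpowersPowerCenter p x, (a : G) ^ p ∈ Subgroup.center G →
      a ^ p ∈ Subgroup.center (zpowersPowerCenter p x) := fun a ha =>
    Subgroup.mem_center_iff.2 fun b => Subtype.ext (Subgroup.mem_center_iff.1 ha b)
  have := congrArg Subtype.val (hT ⟨x, hxT⟩⁻¹ ⟨_, hgT⟩
    (hc _ (by simpa using hx)) (hc _ (by simpa only [hgx] using hx)))
  simpa only [Subgroup.coe_mul, Subgroup.coe_pow, Subgroup.coe_inv, hgx, inv_pow,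
    inv_mul_cancel] using this

theorem inv_mul_conj_mem_powerCenter (hQ : IsQuasiPowerful p G) (x g : G) :
    x⁻¹ * (g * x * g⁻¹) ∈ powerCenter G p := by
  have := hQ.commutator_le
    (Subgroup.commutator_mem_commutator (Subgroup.mem_top x⁻¹) (Subgroup.mem_top g))
  simpa [commutatorElement_def, mul_assoc] using this

/-- An element of order `p` in `G ^ (p ^ r) Z(G)` commutes with all elements of order at most
`p ^ r` modulo the centre: only its factor in `G ^ (p ^ r)` matters. -/
theorem PowCommuteModCenter.commute [Finite G] (hp : p.Prime) (hodd : Odd p)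
    (hG : IsPGroup p G) (hQ : IsQuasiPowerful p G) {r : ℕ} (hr : PowCommuteModCenter p G r)
    {d h : G} (hd : d ∈ powerCenter G (p ^ r)) (hdp : d ^ p = 1)
    (hh : h ^ p ^ r ∈ Subgroup.center G) : Commute d h := by
  obtain ⟨a, ha, z, hz, rfl⟩ := mem_powerCenter_iff.1 hd
  obtain ⟨l, rfl⟩ := (hQ.mem_powerSubgroup_iff hp hodd hG).1 ha
  have hzc : ∀ g : G, Commute g z := fun g => Subgroup.mem_center_iff.1 hz g
  refine (hr h l hh ?_).mul_left (hzc h).symm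
  rw [(hzc _).mul_pow, ← pow_mul, ← pow_succ] at hdp
  rw [eq_inv_of_mul_eq_one_left hdp]
  exact inv_mem (pow_mem hz p)

/-- The elements of `G ^ p Z(G)` of order dividing `p`. -/
def omegaPowerCenter
    (hT : IsPowHomModCenter p (zpowersPowerCenter p (1 : G))) : Subgroup G where
  carrier := {n | n ∈ powerCenter G p ∧ n ^ p = 1}
  one_mem' := ⟨one_mem _, one_pow p⟩
  inv_mem' := fun ⟨h1, h2⟩ => ⟨inv_mem h1, by rw [inv_pow, h2, inv_one]⟩
  mul_mem' := by
    rintro a b ⟨ha, ha'⟩ ⟨hb, hb'⟩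
    refine ⟨mul_mem ha hb, ?_⟩
    have e := zpowersPowerCenter_one (p := p) (G := G)
    have h1 : ∀ (x : G) (hx : x ∈ zpowersPowerCenter p (1 : G)), x ^ p = 1 →
        (⟨x, hx⟩ : zpowersPowerCenter p (1 : G)) ^ p = 1 := fun x hx hxp => Subtype.ext hxp
    have := hT ⟨a, e ▸ ha⟩ ⟨b, e ▸ hb⟩ (by rw [h1 _ _ ha']; exact one_mem _)
      (by rw [h1 _ _ hb']; exact one_mem _)
    rw [h1 _ _ ha', h1 _ _ hb', one_mul] at this
    exact congrArg Subtype.val this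

instance omegaPowerCenter_normal
    (hT : IsPowHomModCenter p (zpowersPowerCenter p (1 : G))) :
    (omegaPowerCenter hT).Normal :=
  ⟨fun n hn g => ⟨Subgroup.Normal.conj_mem inferInstance n hn.1 g, by
    rw [conj_pow, hn.2]; group⟩⟩

theorem card_quotient_omegaPowerCenter_lt [Finite G] [Nontrivial G] (hp : p.Prime)
    (hG : IsPGroup p G) (hT : IsPowHomModCenter p (zpowersPowerCenter p (1 : G))) :
    Nat.card (G ⧸ omegaPowerCenter hT) < Nat.card G := by
  have : Fact p.Prime := ⟨hp⟩
  have hZ : Nontrivial (Subgroup.center G) := hG.center_nontrivial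
  obtain ⟨n, hn0, hn⟩ := (hG.to_subgroup (Subgroup.center G)).nontrivial_iff_card.1 hZ
  obtain ⟨z, hz⟩ := exists_prime_orderOf_dvd_card' (G := Subgroup.center G) p
    (hn ▸ dvd_pow_self p hn0.ne')
  have hzN : (z : G) ∈ omegaPowerCenter hT :=
    ⟨Subgroup.mem_sup_right z.2, by
      have := pow_orderOf_eq_one z
      rw [hz] at this
      exact congrArg Subtype.val this⟩
  have hne : omegaPowerCenter hT ≠ ⊥ := by
    intro e
    rw [e, Subgroup.mem_bot] at hzN
    have : z = 1 := Subtype.ext hzN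
    rw [this, orderOf_one] at hz
    exact hp.one_lt.ne hz
  rw [Subgroup.card_eq_card_quotient_mul_card_subgroup (omegaPowerCenter hT)]
  exact lt_mul_of_one_lt_right Nat.card_pos ((Subgroup.one_lt_card_iff_ne_bot _).2 hne)

end

/-- The passage from `r + 1` to `r = s + 1` for `PowCommuteModCenter`. Put `k' = k ^ p ^ s`. The
commutator `c` of `k'` and `h` has order dividing `p`: for `s = 0` by
`pow_inv_mul_conj_eq_one`, and for `s > 0` because `k'` and `h` commute modulo
`omegaPowerCenter`, by the statement for `s` in that quotient. The commutator `d` of `c` and `k'`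
lies one step further down the power series than `c`, so it commutes with both by the case `r + 1`,
and collection gives `(h * k' * h⁻¹) ^ p = (k' * c) ^ p = k' ^ p`. -/
theorem PowCommuteModCenter.of_succ {p : ℕ} (hp : p.Prime) (hodd : Odd p)
    {G : Type u} [Group G] [Finite G] [Nontrivial G] (hG : IsPGroup p G)
    (hQ : IsQuasiPowerful p G)
    (hT : ∀ x : G, IsPowHomModCenter p (zpowersPowerCenter p x))
    (hN : ∀ r, 1 ≤ r → PowCommuteModCenter p (G ⧸ omegaPowerCenter (hT 1)) r)
    {s : ℕ} (hs : PowCommuteModCenter p G (s + 2)) : PowCommuteModCenter p G (s + 1) := by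
  intro h k hh hk
  set N := omegaPowerCenter (hT 1) with hNdef
  set k' := k ^ p ^ s with hk'
  set c := k'⁻¹ * (h * k' * h⁻¹) with hc
  have hcL : c ∈ powerCenter G p := inv_mul_conj_mem_powerCenter hQ k' h
  have hcp : c ^ p = 1 := by
    cases s with
    | zero =>
      have h1 := pow_inv_mul_conj_eq_one hQ (hT h⁻¹) (by simpa using hh) k'⁻¹
      have e : (h⁻¹)⁻¹ * (k'⁻¹ * h⁻¹ * (k'⁻¹)⁻¹) = c⁻¹ := by rw [hc]; group
      rw [e, inv_pow, inv_eq_one] at h1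
      exact h1
    | succ s =>
      have hcen : ∀ a : G, a ^ p ∈ Subgroup.center G → (a : G ⧸ N) ∈ Subgroup.center (G ⧸ N) := by
        intro a ha
        refine Subgroup.mem_center_iff.2 fun q => ?_
        obtain ⟨g, rfl⟩ := QuotientGroup.mk_surjective q
        have hm : a⁻¹ * (g * a * g⁻¹) ∈ N :=
          ⟨inv_mul_conj_mem_powerCenter hQ a g, pow_inv_mul_conj_eq_one hQ (hT a) ha g⟩
        have := QuotientGroup.eq.2 hm
        rw [QuotientGroup.mk_mul, QuotientGroup.mk_mul, QuotientGroup.mk_inv,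
          eq_mul_inv_iff_mul_eq] at this
        exact this.symm
      have h1 : Commute ((k : G ⧸ N) ^ p ^ (s + 1)) (h : G ⧸ N) := by
        refine hN (s + 1) (by omega) h k ?_ ?_
        · exact hcen (h ^ p ^ (s + 1)) (by rwa [← pow_mul, ← pow_succ])
        · exact hcen (k ^ p ^ (s + 2)) (by rwa [← pow_mul, ← pow_succ])
      have h2 : (k' : G ⧸ N) = ((h * k' * h⁻¹ : G) : G ⧸ N) := by
        rw [QuotientGroup.mk_mul, QuotientGroup.mk_mul, QuotientGroup.mk_inv,
          eq_mul_inv_iff_mul_eq]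
        exact h1
      exact (QuotientGroup.eq.1 h2 : c ∈ N).2
  have hcN : c ∈ N := ⟨hcL, hcp⟩
  set d := c⁻¹ * k'⁻¹ * c * k' with hd
  have hdN : d ∈ N := by
    have : d = c⁻¹ * (k'⁻¹ * c * (k'⁻¹)⁻¹) := by rw [hd]; group
    rw [this]
    exact mul_mem (inv_mem hcN) (Subgroup.Normal.conj_mem inferInstance c hcN _)
  have hchain := fun i => (hQ.exists_pow_eq_and_commutator_le hp hodd hG i).2
  have hcr : c ∈ powerCenter G (p ^ (s + 1)) := by
    have := hchain s (Subgroup.commutator_mem_commutator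
      (inv_mem (Subgroup.mem_sup_left (pow_mem_powerSubgroup k (p ^ s)))) (Subgroup.mem_top h))
    simpa [commutatorElement_def, hc, hk', mul_assoc] using this
  have hdr : d ∈ powerCenter G (p ^ (s + 2)) := by
    have := hchain (s + 1) (Subgroup.commutator_mem_commutator (inv_mem hcr)
      (Subgroup.mem_top k'⁻¹))
    simpa [commutatorElement_def, hd, mul_assoc] using this
  have hdk : Commute d k' := by
    refine hs.commute hp hodd hG hQ hdr hdN.2 ?_
    rw [hk', ← pow_mul, ← pow_add, show s + (s + 2) = s + 2 + s by ring, pow_add, pow_mul]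
    exact pow_mem hk _
  have hdc : Commute d c := by
    refine hs.commute hp hodd hG hQ hdr hdN.2 ?_
    rw [pow_succ', pow_mul, hcp, one_pow]
    exact one_mem _
  have hfin := mul_pow_prime_of_pow_eq_one hp hodd (x := k') (c := c) (d := d)
    (by rw [hd]; group) hdk hdc hcp
  have e : k' * c = h * k' * h⁻¹ := by rw [hc]; group
  rw [e, conj_pow, mul_inv_eq_iff_eq_mul, hk', ← pow_mul, ← pow_succ] at hfin
  exact hfin.symm

/-- The two statements are proved together by induction on the group order: the first is inherited
from the subgroups `⟨x⟩ G ^ p Z(G)` through `pow_inv_mul_conj_eq_one` and the second one for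
`r = 1`; the second comes by downward induction on `r`. -/
theorem IsQuasiPowerful.isPowHomModCenter_and_powCommuteModCenter {p : ℕ} (hp : p.Prime)
    (hodd : Odd p) {G : Type u} [Group G] [Finite G] (hG : IsPGroup p G)
    (hQ : IsQuasiPowerful p G) :
    IsPowHomModCenter p G ∧ ∀ r, 1 ≤ r → PowCommuteModCenter p G r := by
  induction hn : Nat.card G using Nat.strong_induction_on generalizing G with
  | _ n ih =>
    subst hn
    have := hG.group_isNilpotent hp
    by_cases hcomm : ∀ a b : G, a * b = b * a
    · exact ⟨fun x y _ _ => (show Commute x y from hcomm x y).mul_pow p,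
        fun r _ h k _ _ => hcomm _ _⟩
    have hnt : Nontrivial G := by
      by_contra hs
      rw [not_nontrivial_iff_subsingleton] at hs
      exact hcomm fun a b => Subsingleton.elim _ _
    have hT : ∀ x : G, IsPowHomModCenter p (_root_.zpowersPowerCenter p x) := fun x =>
      (ih _ (card_lt_of_ne_top (hG.zpowersPowerCenter_ne_top hp hcomm x)) (hG.to_subgroup _)
        (hQ.zpowersPowerCenter hp hodd x) rfl).1
    have hN : ∀ r, 1 ≤ r → PowCommuteModCenter p (G ⧸ omegaPowerCenter (hT 1)) r :=
      (ih _ (card_quotient_omegaPowerCenter_lt hp hG (hT 1)) (hG.to_quotient _)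
        (hQ.quotient _) rfl).2
    obtain ⟨R, hR⟩ : ∃ R, Nat.card G = p ^ R :=
      have : Fact p.Prime := ⟨hp⟩
      IsPGroup.iff_card.1 hG
    have hdown : ∀ m r, 1 ≤ r → R ≤ r + m → PowCommuteModCenter p G r := by
      intro m
      induction m with
      | zero =>
        intro r _ hr h k _ _
        have : k ^ p ^ r = 1 :=
          orderOf_dvd_iff_pow_eq_one.1 ((orderOf_dvd_natCard k).trans (hR ▸ pow_dvd_pow p hr))
        rw [this]
        exact Commute.one_left h
      | succ m ihm =>
        intro r hr hrm
        obtain ⟨s, rfl⟩ : ∃ s, r = s + 1 := ⟨r - 1, by omega⟩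
        exact PowCommuteModCenter.of_succ hp hodd hG hQ hT hN (ihm (s + 2) (by omega) (by omega))
    have hall : ∀ r, 1 ≤ r → PowCommuteModCenter p G r := fun r hr => hdown R r hr (by omega)
    refine ⟨fun x y hx hy => ?_, hall⟩
    set d := y⁻¹ * (x⁻¹ * y * (x⁻¹)⁻¹) with hd
    have hdp : d ^ p = 1 := pow_inv_mul_conj_eq_one hQ (hT y) hy x⁻¹
    have hdL : d ∈ powerCenter G (p ^ 1) := by
      rw [pow_one]; exact inv_mul_conj_mem_powerCenter hQ y x⁻¹
    have hcom : ∀ g : G, g ^ p ∈ Subgroup.center G → Commute d g := fun g hg =>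
      (hall 1 le_rfl).commute hp hodd hG hQ hdL hdp (by rwa [pow_one])
    exact mul_pow_prime_of_commutator_commute hp hodd (by rw [hd]; group) (hcom x hx) (hcom y hy) hdp

/-! ### Omega subgroups -/

theorem mem_omegaSubgroup_of_pow_eq_one {G : Type*} [Group G] {p i : ℕ} {g : G}
    (hg : g ^ p ^ i = 1) : g ∈ omegaSubgroup G p i :=
  Subgroup.subset_closure hg

theorem mem_omegaSubgroup_iff_of_mul {G : Type*} [Group G] {p i : ℕ}
    (h : ∀ a b : G, a ^ p ^ i = 1 → b ^ p ^ i = 1 → (a * b) ^ p ^ i = 1) {g : G} :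
    g ∈ omegaSubgroup G p i ↔ g ^ p ^ i = 1 := by
  refine ⟨fun hg => ?_, mem_omegaSubgroup_of_pow_eq_one⟩
  induction hg using Subgroup.closure_induction with
  | mem x hx => exact hx
  | one => exact one_pow _
  | mul a b _ _ ha hb => exact h a b ha hb
  | inv a _ ha => rw [inv_pow, ha, inv_one]

instance omegaSubgroup_normal {G : Type*} [Group G] (p i : ℕ) : (omegaSubgroup G p i).Normal := by
  refine ⟨fun y hy g => ?_⟩
  have : omegaSubgroup G p i ≤ (omegaSubgroup G p i).comap (MulAut.conj g).toMonoidHom :=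
    (Subgroup.closure_le _).2 fun x (hx : x ^ p ^ i = 1) =>
      mem_omegaSubgroup_of_pow_eq_one (by
        have : (g * x * g⁻¹) ^ p ^ i = 1 := by rw [conj_pow, hx]; group
        simpa using this)
  simpa using this hy

theorem IsQuasiPowerful.mem_omegaSubgroup_one_iff {p : ℕ} (hp : p.Prime) (hodd : Odd p)
    {G : Type u} [Group G] [Finite G] (hG : IsPGroup p G) (hQ : IsQuasiPowerful p G) {g : G} :
    g ∈ omegaSubgroup G p 1 ↔ g ^ p = 1 := by
  rw [mem_omegaSubgroup_iff_of_mul, pow_one]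
  intro a b ha hb
  rw [pow_one] at ha hb ⊢
  rw [(hQ.isPowHomModCenter_and_powCommuteModCenter hp hodd hG).1 a b
    (ha ▸ one_mem _) (hb ▸ one_mem _), ha, hb, one_mul]

/-- Elements of order at most `p ^ i` multiply to such an element: for `i > 1` pass to the quotient
by the subgroup of elements of order at most `p`. -/
theorem IsQuasiPowerful.mul_pow_eq_one {p : ℕ} (hp : p.Prime) (hodd : Odd p) (i : ℕ)
    {G : Type u} [Group G] [Finite G] (hG : IsPGroup p G) (hQ : IsQuasiPowerful p G) (a b : G)
    (ha : a ^ p ^ i = 1) (hb : b ^ p ^ i = 1) : (a * b) ^ p ^ i = 1 := by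
  induction i generalizing G with
  | zero => simp_all
  | succ i ih =>
    have hO : ∀ g : G, (g : G ⧸ omegaSubgroup G p 1) ^ p ^ i = 1 ↔ g ^ p ^ (i + 1) = 1 := by
      intro g
      rw [← QuotientGroup.mk_pow, QuotientGroup.eq_one_iff,
        hQ.mem_omegaSubgroup_one_iff hp hodd hG, ← pow_mul, ← pow_succ]
    rw [← hO] at ha hb ⊢
    rw [QuotientGroup.mk_mul]
    exact ih (hG.to_quotient _) (hQ.quotient _) _ _ ha hb

theorem IsQuasiPowerful.mem_omegaSubgroup_iff {p : ℕ} (hp : p.Prime) (hodd : Odd p)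
    {G : Type u} [Group G] [Finite G] (hG : IsPGroup p G) (hQ : IsQuasiPowerful p G) {i : ℕ}
    {g : G} : g ∈ omegaSubgroup G p i ↔ g ^ p ^ i = 1 :=
  mem_omegaSubgroup_iff_of_mul (hQ.mul_pow_eq_one hp hodd i hG)

/-! ### The index of the power subgroups -/

theorem card_map_mul_card_inf_ker {G G' : Type*} [Group G] [Group G'] (f : G →* G')
    (H : Subgroup G) :
    Nat.card (H.map f) * Nat.card (f.ker ⊓ H : Subgroup G) = Nat.card H := by
  rw [← Subgroup.relIndex_ker, ← Subgroup.inf_relIndex_right, mul_comm,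
    ← Subgroup.relIndex_bot_left, ← Subgroup.relIndex_bot_left (H := H)]
  exact Subgroup.relIndex_mul_relIndex _ _ _ bot_le inf_le_right

theorem card_comap_mk {G : Type*} [Group G] (N : Subgroup G) [N.Normal] (K : Subgroup (G ⧸ N)) :
    Nat.card K * Nat.card N = Nat.card (K.comap (QuotientGroup.mk' N)) := by
  have h := card_map_mul_card_inf_ker (QuotientGroup.mk' N) (K.comap (QuotientGroup.mk' N))
  rw [Subgroup.map_comap_eq_self_of_surjective (QuotientGroup.mk'_surjective N),
    inf_eq_left.2 (Subgroup.ker_le_comap _ K), QuotientGroup.ker_mk'] at h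
  exact h

theorem card_powerSubgroup_quotient {G : Type*} [Group G] (N : Subgroup G) [N.Normal] (n : ℕ) :
    Nat.card (powerSubgroup (G ⧸ N) n) * Nat.card (N ⊓ powerSubgroup G n : Subgroup G) =
      Nat.card (powerSubgroup G n) := by
  have h := card_map_mul_card_inf_ker (QuotientGroup.mk' N) (powerSubgroup G n)
  rwa [map_powerSubgroup_of_surjective (QuotientGroup.mk'_surjective N),
    QuotientGroup.ker_mk'] at h

/-- By induction through `G ⧸ Z(G)`: the `p`-th power map is a homomorphism from the elements of
order at most `p` modulo `Z(G)` to `Z(G)`, its kernel is `Ω₁(G)` and its range is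
`Z(G) ∩ G ^ p`. -/
theorem IsQuasiPowerful.card_powerSubgroup_mul_card_omegaSubgroup_one {p : ℕ} (hp : p.Prime)
    (hodd : Odd p) {G : Type u} [Group G] [Finite G] (hG : IsPGroup p G)
    (hQ : IsQuasiPowerful p G) :
    Nat.card (_root_.powerSubgroup G p) * Nat.card (omegaSubgroup G p 1) = Nat.card G := by
  induction hn : Nat.card G using Nat.strong_induction_on generalizing G with
  | _ n ih =>
    subst hn
    have : Fact p.Prime := ⟨hp⟩
    rcases subsingleton_or_nontrivial G with hs | hnt
    · simp
    set Z := Subgroup.center G with hZ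
    have hZnt : Nontrivial Z := hG.center_nontrivial
    have hcard := Subgroup.card_eq_card_quotient_mul_card_subgroup Z
    have hQq := hQ.quotient Z
    have hGq := hG.to_quotient Z
    have hlt : Nat.card (G ⧸ Z) < Nat.card G := by
      rw [hcard]
      exact lt_mul_of_one_lt_right Nat.card_pos (Finite.one_lt_card_iff_nontrivial.2 hZnt)
    have hih := ih _ hlt hGq hQq rfl
    set S := (omegaSubgroup (G ⧸ Z) p 1).comap (QuotientGroup.mk' Z) with hS
    have hmemS : ∀ x : G, x ∈ S ↔ x ^ p ∈ Z := fun x => by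
      rw [hS, Subgroup.mem_comap, hQq.mem_omegaSubgroup_one_iff hp hodd hGq, ← map_pow]
      exact QuotientGroup.eq_one_iff _
    have hhom := (hQ.isPowHomModCenter_and_powCommuteModCenter hp hodd hG).1
    let f : S →* G := MonoidHom.mk' (fun x => (x : G) ^ p) fun x y =>
      hhom x y ((hmemS x).1 x.2) ((hmemS y).1 y.2)
    have hf : ∀ x : S, f x = (x : G) ^ p := fun _ => rfl
    have hrange : f.range = Z ⊓ _root_.powerSubgroup G p := by
      ext w
      constructor
      · rintro ⟨x, rfl⟩
        exact ⟨(hmemS x).1 x.2, pow_mem_powerSubgroup _ p⟩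
      · rintro ⟨hw, hw'⟩
        obtain ⟨x, rfl⟩ := hQ.exists_pow_prime_eq hp hodd hG hw'
        exact ⟨⟨x, (hmemS x).2 hw⟩, rfl⟩
    have hker : f.ker.map S.subtype = omegaSubgroup G p 1 := by
      ext x
      rw [hQ.mem_omegaSubgroup_one_iff hp hodd hG]
      constructor
      · rintro ⟨y, hy, rfl⟩
        exact hy
      · intro hx
        exact ⟨⟨x, (hmemS x).2 (hx ▸ one_mem _)⟩, hx, rfl⟩
    have h1 := card_powerSubgroup_quotient Z p
    have h2 : Nat.card (omegaSubgroup (G ⧸ Z) p 1) * Nat.card Z = Nat.card S := card_comap_mk Z _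
    have h3 : Nat.card (Z ⊓ _root_.powerSubgroup G p : Subgroup G) *
        Nat.card (omegaSubgroup G p 1) = Nat.card S := by
      have := card_map_mul_card_inf_ker f ⊤
      rw [← MonoidHom.range_eq_map, hrange, inf_top_eq, Subgroup.card_top] at this
      rw [← hker, Subgroup.card_map_of_injective S.subtype_injective, this]
    rw [← h1, mul_assoc, h3, ← h2, ← mul_assoc, hih, ← hcard]

/-- By induction on `i` through `G ⧸ Ω₁(G)`, applying the case `i = 1` to `G ^ (p ^ i)`. -/
theorem IsQuasiPowerful.card_powerSubgroup_mul_card_omegaSubgroup {p : ℕ} (hp : p.Prime)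
    (hodd : Odd p) (i : ℕ) {G : Type u} [Group G] [Finite G] (hG : IsPGroup p G)
    (hQ : IsQuasiPowerful p G) :
    Nat.card (_root_.powerSubgroup G (p ^ i)) * Nat.card (omegaSubgroup G p i) = Nat.card G := by
  induction i generalizing G with
  | zero =>
    have h1 : _root_.powerSubgroup G (p ^ 0) = ⊤ :=
      eq_top_iff.2 fun x _ => by
        have := pow_mem_powerSubgroup x (p ^ 0)
        rw [pow_zero] at this ⊢
        rwa [pow_one] at this
    have h2 : omegaSubgroup G p 0 = ⊥ :=
      eq_bot_iff.2 fun x hx => by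
        rw [hQ.mem_omegaSubgroup_iff hp hodd hG, pow_zero, pow_one] at hx
        exact hx
    rw [h1, h2, Subgroup.card_top, Subgroup.card_bot, mul_one]
  | succ i ih =>
    set O := omegaSubgroup G p 1 with hO
    set P := _root_.powerSubgroup G (p ^ i) with hP
    have hQq := hQ.quotient O
    have hGq := hG.to_quotient O
    have hmemO : ∀ x : G, x ∈ O ↔ x ^ p = 1 := fun x => hQ.mem_omegaSubgroup_one_iff hp hodd hG
    have homega : (omegaSubgroup (G ⧸ O) p i).comap (QuotientGroup.mk' O) =
        omegaSubgroup G p (i + 1) := by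
      ext x
      rw [Subgroup.mem_comap, hQq.mem_omegaSubgroup_iff hp hodd hGq, ← map_pow,
        hQ.mem_omegaSubgroup_iff hp hodd hG, pow_succ, pow_mul, ← hmemO]
      exact QuotientGroup.eq_one_iff _
    have h1 := card_comap_mk O (omegaSubgroup (G ⧸ O) p i)
    rw [homega] at h1
    have h2 := card_powerSubgroup_quotient O (p ^ i)
    have hQP := hQ.powerSubgroup hp hodd hG i
    have hGP := hG.to_subgroup P
    have h3 := hQP.card_powerSubgroup_mul_card_omegaSubgroup_one hp hodd hGP
    have hpow : P.powersOf p = _root_.powerSubgroup G (p ^ (i + 1)) := by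
      refine le_antisymm (Subgroup.powersOf_le_iff.2 fun x hx => ?_) (powerSubgroup_pow_succ_le i)
      obtain ⟨g, rfl⟩ := (hQ.mem_powerSubgroup_iff hp hodd hG).1 hx
      rw [← pow_mul, ← pow_succ]
      exact pow_mem_powerSubgroup g _
    have homP : (omegaSubgroup P p 1).map P.subtype = O ⊓ P := by
      ext x
      constructor
      · rintro ⟨y, hy, rfl⟩
        have := (hQP.mem_omegaSubgroup_one_iff hp hodd hGP).1 hy
        exact ⟨(hmemO _).2 (congrArg Subtype.val this), y.2⟩
      · rintro ⟨hx, hxP⟩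
        exact ⟨⟨x, hxP⟩, (hQP.mem_omegaSubgroup_one_iff hp hodd hGP).2
          (Subtype.ext ((hmemO x).1 hx)), rfl⟩
    rw [← Subgroup.card_map_of_injective (f := P.subtype) P.subtype_injective, map_subtype_powerSubgroup, hpow,
      ← Subgroup.card_map_of_injective (K := omegaSubgroup P p 1) (f := P.subtype) P.subtype_injective, homP,
      ← h2] at h3
    rw [Nat.eq_of_mul_eq_mul_right Nat.card_pos h3, ← h1, ← mul_assoc, ih hGq hQq,
      ← Subgroup.card_eq_card_quotient_mul_card_subgroup]

/-! ### The regular power structure -/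

theorem IsPGroup.orderOf_le_pow_iff {p : ℕ} (hp : p.Prime) {G : Type*} [Group G]
    (hG : IsPGroup p G) {i : ℕ} {g : G} : orderOf g ≤ p ^ i ↔ g ^ p ^ i = 1 := by
  have : Fact p.Prime := ⟨hp⟩
  rw [← orderOf_dvd_iff_pow_eq_one]
  refine ⟨fun h => ?_, Nat.le_of_dvd (pow_pos hp.pos i)⟩
  obtain ⟨k, hk⟩ := IsPGroup.iff_orderOf.1 hG g
  rw [hk] at h ⊢
  exact pow_dvd_pow p ((Nat.pow_le_pow_iff_right hp.one_lt).1 h)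

theorem theorem1 (p : ℕ) (hp : p.Prime) (hodd : Odd p) (G : Type*) [Group G]
    (hG : IsQuasiPowerfulPGroup p G) :
    (∀ i : ℕ,
      (∀ a b : G, orderOf a ≤ p ^ i → orderOf b ≤ p ^ i → orderOf (a * b) ≤ p ^ i) ∧
      Monoid.exponent (omegaSubgroup G p i) ≤ p ^ i ∧
      (powerSubgroup G (p ^ i) : Set G) = {x : G | ∃ g : G, g ^ (p ^ i) = x} ∧
      (powerSubgroup G (p ^ i)).index = Nat.card (omegaSubgroup G p i)) ∧
    HasRegularPowerStructure p G := by
  have hfin := hG.finite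
  have hpG := hG.isPGroup
  have hQ := hG.isQuasiPowerful (by rintro rfl; exact absurd hodd (by decide))
  have hord : ∀ (i : ℕ) (g : G), orderOf g ≤ p ^ i ↔ g ^ p ^ i = 1 :=
    fun _ _ => hpG.orderOf_le_pow_iff hp
  have hmem : ∀ (i : ℕ) (g : G), g ∈ omegaSubgroup G p i ↔ g ^ p ^ i = 1 :=
    fun _ _ => hQ.mem_omegaSubgroup_iff hp hodd hpG
  have hpow : ∀ i : ℕ, (powerSubgroup G (p ^ i) : Set G) = {x : G | ∃ g : G, g ^ (p ^ i) = x} :=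
    fun i => Set.ext fun x => hQ.mem_powerSubgroup_iff hp hodd hpG
  have hindex : ∀ i : ℕ, (powerSubgroup G (p ^ i)).index = Nat.card (omegaSubgroup G p i) := by
    intro i
    refine Nat.eq_of_mul_eq_mul_left (Nat.card_pos (α := powerSubgroup G (p ^ i))) ?_
    rw [Subgroup.card_mul_index, hQ.card_powerSubgroup_mul_card_omegaSubgroup hp hodd i hpG]
  refine ⟨fun i => ⟨fun a b ha hb => ?_, ?_, hpow i, hindex i⟩,
    ⟨hfin, hpG, fun i _ => hpow i, fun i _ => ?_, fun i _ => hindex i⟩⟩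
  · rw [hord] at ha hb ⊢
    exact hQ.mul_pow_eq_one hp hodd i hpG a b ha hb
  · exact Nat.le_of_dvd (pow_pos hp.pos i) (Monoid.exponent_dvd_of_forall_pow_eq_one
      fun g => Subtype.ext ((hmem i g).1 g.2))
  · ext g
    exact (hmem i g).trans (hord i g).symm
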